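/- **Model.** A power function is a nonnegative continuous function $P$ on a set of allowed speeds $S\subseteq[0,\infty)$ with $0\in S$. A job sequence $I$ consists of finitely many jobs $j$ with release times $r(j)\ge 0$ and sizes $p(j)>0$. A schedule processes, at each time $t\ge 0$, the released jobs at nonnegative (locally integrable) rates whose sum is the speed $s(t)\in S$ (so preemption and processor sharing are allowed), never processing a job beyond its size; a job is completed at the time at which the work done on it reaches its size. The cost of a schedule is its total flow time $\sum_j (C(j)-r(j))$, where $C(j)\in[0,\infty]$ is the completion time of $j$, plus its energy $\int_0^{C} P(s(t))\,dt$, where $C=\max_j C(j)$ is the time at which all jobs are completed. A deterministic algorithm assigns a schedule to every job sequence; it is (online) nonclairvoyant if its decision at each time $t$ depends only on the jobs released up to time $t$ and their release times, and on the jobs completed up to time $t$, their completion times and their sizes. It is $c$-competitive if for every job sequence its cost is at most $c$ times the infimum of the costs of all schedules of that sequence. **Theorem.** There is a power function $P$ for which every deterministic nonclairvoyant algorithm is $\omega(1)$-competitive, that is, for which no such algorithm is $c$-competitive for any constant $c$. For example, this holds for $$P(s)=\frac{1}{(4(2-s))^{1/4}},\qquad 0\le s<2,$$ with allowed speeds $[0,2)$,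 which is nonnegative, continuous and strictly convex, tends to $\infty$ as $s\to 2^-$, and satisfies $P'(s)=P(s)^5$ for all $0\le s<2$. -/

import Mathlib

open scoped ENNReal NNReal

/-- A power function: the set of speeds at which the processor can run, and the power consumed
at each of these speeds. The values of `power` outside `speeds` are never used. -/
structure PowerFunction where
  speeds : Set ℝ
  power : ℝ → ℝ
  zero_mem : (0 : ℝ) ∈ speeds
  speeds_nonneg : ∀ s ∈ speeds, 0 ≤ s
  power_nonneg : ∀ s ∈ speeds, 0 ≤ power s
  power_continuousOn : ContinuousOn power speeds

/-- A finite job sequence: the jobs are `0, …, num - 1`, numbered in order of arrival; job `j` has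
release time `release j` and work requirement `size j`. -/
structure JobSequence where
  num : ℕ
  release : ℕ → ℝ
  size : ℕ → ℝ
  release_nonneg : ∀ j < num, 0 ≤ release j
  release_mono : ∀ i j, i ≤ j → j < num → release i ≤ release j
  size_pos : ∀ j < num, 0 < size j

/-- Job `j` exists and has been released by time `t`. -/
def JobSequence.Released (I : JobSequence) (j : ℕ) (t : ℝ) : Prop :=
  j < I.num ∧ I.release j ≤ t

/-- A (preemptive, single processor) schedule of the job sequence `I`. At time `t` the processor
works on job `j` at rate `rate j t`; its speed is the sum of these rates and has to be an allowed
one. Jobs are not processed before their release or beyond their size. A schedule is allowed to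
leave jobs unfinished for ever; it then has infinite flow time. -/
structure Schedule (P : PowerFunction) (I : JobSequence) where
  rate : ℕ → ℝ → ℝ
  rate_nonneg : ∀ j t, 0 ≤ rate j t
  rate_integrable : ∀ j t, 0 ≤ t → IntervalIntegrable (rate j) MeasureTheory.volume 0 t
  rate_eq_zero : ∀ j t, ¬ I.Released j t → rate j t = 0
  speed_mem : ∀ t, ∑ j ∈ Finset.range I.num, rate j t ∈ P.speeds
  work_le_size : ∀ j < I.num, ∀ t, 0 ≤ t → ∫ τ in (0 : ℝ)..t, rate j τ ≤ I.size j

noncomputable section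

namespace Schedule

variable {P : PowerFunction} {I : JobSequence}

/-- The speed of the processor at time `t`. -/
def speed (A : Schedule P I) (t : ℝ) : ℝ := ∑ j ∈ Finset.range I.num, A.rate j t

/-- The amount of work done on job `j` during `[0, t]`. -/
def work (A : Schedule P I) (j : ℕ) (t : ℝ) : ℝ := ∫ τ in (0 : ℝ)..t, A.rate j τ

/-- Job `j` is completed by time `t`. -/
def Completed (A : Schedule P I) (j : ℕ) (t : ℝ) : Prop :=
  I.Released j t ∧ I.size j ≤ A.work j t

/-- The time at which job `j` is completed (`∞` if this never happens). -/
def completionTime (A : Schedule P I) (j : ℕ) : ℝ≥0∞ :=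
  ⨅ (t : ℝ) (_ : A.Completed j t), ENNReal.ofReal t

/-- The flow time of job `j`: the time elapsed from its release to its completion. -/
def jobFlow (A : Schedule P I) (j : ℕ) : ℝ≥0∞ :=
  A.completionTime j - ENNReal.ofReal (I.release j)

/-- The total flow time. -/
def flow (A : Schedule P I) : ℝ≥0∞ := ∑ j ∈ Finset.range I.num, A.jobFlow j

/-- The time at which the last job is completed. -/
def makespan (A : Schedule P I) : ℝ≥0∞ := ⨆ j ∈ Finset.range I.num, A.completionTime j

/-- The total energy used from time `0` until all jobs are completed. From then on the speed is
`0` almost everywhere, so for a power function that vanishes at speed `0` this is the integral of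
the power over `[0, ∞)`. -/
def energy (A : Schedule P I) : ℝ≥0∞ :=
  ∫⁻ t in {t : ℝ | 0 ≤ t ∧ ENNReal.ofReal t < A.makespan}, ENNReal.ofReal (P.power (A.speed t))

/-- The objective: total flow time plus energy. -/
def cost (A : Schedule P I) : ℝ≥0∞ := A.flow + A.energy

end Schedule

/-- The optimal offline cost of the job sequence `I`. -/
def optCost (P : PowerFunction) (I : JobSequence) : ℝ≥0∞ := ⨅ A : Schedule P I, A.cost

/-- A deterministic scheduling algorithm produces a schedule for every job sequence. -/
abbrev Algorithm (P : PowerFunction) := (I : JobSequence) → Schedule P I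

/-- What a nonclairvoyant scheduler has seen up to time `t` is the same when `A` is run on `I` and
when it is run on `I'`: the jobs released so far and their release times, and the jobs completed
so far with the times of their completion and their sizes. -/
def Algorithm.SameHistory {P : PowerFunction} (A : Algorithm P) (I I' : JobSequence) (t : ℝ) :
    Prop :=
  (∀ j, I.Released j t ↔ I'.Released j t) ∧
  (∀ j, I.Released j t → I.release j = I'.release j) ∧
  (∀ j, ∀ τ ≤ t, (A I).Completed j τ ↔ (A I').Completed j τ) ∧
  (∀ j, (A I).Completed j t → I.size j = I'.size j)

/-- `A` is an online nonclairvoyant algorithm: its decision at any time is determined by what has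
been seen up to that time. -/
def Algorithm.IsNonclairvoyant {P : PowerFunction} (A : Algorithm P) : Prop :=
  ∀ (I I' : JobSequence) (t : ℝ), A.SameHistory I I' t → ∀ j, (A I).rate j t = (A I').rate j t

/-- `A` is `c`-competitive for total flow time plus energy. -/
def Algorithm.IsCompetitive {P : PowerFunction} (A : Algorithm P) (c : ℝ≥0) : Prop :=
  ∀ I : JobSequence, (A I).cost ≤ (c : ℝ≥0∞) * optCost P I

end

/-! Let `v` be an allowed speed close to the top speed `u`. Release a batch of `n` jobs at time `0`
and a stream of `n ^ 3` jobs of size `1` at rate `v` from time `T = 2 * n ^ 2 / u` on. A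
nonclairvoyant algorithm does not know the sizes, so those of the batch can be chosen in hindsight
such that at time `T` every job has exactly one unit of work left. From then on the algorithm gains
on the stream only at rate `u - v`, so some `n` jobs stay active during the whole stream and its
flow time is of order `n ^ 4`.

Offline, one postpones until the end a job of the batch that has received an average share of the
work. The time this saves (about `2 * n` units of work) pays for the missing `n` units and for the
speed `v < u`, so the rest of the batch is completed by time `T`, every job of the stream is
processed on release, and the cost is of order `(1 + P v) * n ^ 3`.

This works as long as `n ^ 2` is at most of order `1 / (u - v)`. So a constant competitive ratio
forces `P v` to grow at least like `(u - v) ^ (-1 / 2)` as `v → u`, but the barrier power grows only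
like `(u - v) ^ (-1 / 4)`. -/

open MeasureTheory Set Filter Topology Asymptotics
open scoped Finset

namespace Schedule

variable {P : PowerFunction} {I : JobSequence}

theorem work_zero (S : Schedule P I) (j : ℕ) : S.work j 0 = 0 :=
  intervalIntegral.integral_same

theorem intervalIntegrable_rate (S : Schedule P I) (j : ℕ) {a b : ℝ} (ha : 0 ≤ a) (hb : 0 ≤ b) :
    IntervalIntegrable (S.rate j) volume a b :=
  (S.rate_integrable j a ha).symm.trans (S.rate_integrable j b hb)

theorem work_sub_work (S : Schedule P I) (j : ℕ) {a b : ℝ} (ha : 0 ≤ a) (hb : 0 ≤ b) :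
    S.work j b - S.work j a = ∫ τ in a..b, S.rate j τ :=
  intervalIntegral.integral_interval_sub_left (S.rate_integrable j b hb)
    (S.rate_integrable j a ha)

theorem work_mono (S : Schedule P I) (j : ℕ) {a b : ℝ} (ha : 0 ≤ a) (hab : a ≤ b) :
    S.work j a ≤ S.work j b := by
  rw [← sub_nonneg, S.work_sub_work j ha (ha.trans hab)]
  exact intervalIntegral.integral_nonneg hab fun τ _ => S.rate_nonneg j τ

theorem work_nonneg (S : Schedule P I) (j : ℕ) {t : ℝ} (ht : 0 ≤ t) : 0 ≤ S.work j t :=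
  S.work_zero j ▸ S.work_mono j le_rfl ht

theorem continuousOn_work (S : Schedule P I) (j : ℕ) {t : ℝ} (ht : 0 ≤ t) :
    ContinuousOn (S.work j) (Icc 0 t) := by
  rw [← uIcc_of_le ht]
  exact intervalIntegral.continuousOn_primitive_interval' (S.rate_integrable j t ht) left_mem_uIcc

theorem work_eq_zero (S : Schedule P I) {j : ℕ} {t : ℝ} (ht : 0 ≤ t)
    (h : ∀ τ < t, ¬ I.Released j τ) : S.work j t = 0 := by
  rw [work, intervalIntegral.integral_of_le ht, integral_Ioc_eq_integral_Ioo]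
  exact setIntegral_eq_zero_of_forall_eq_zero fun τ hτ => S.rate_eq_zero j τ (h τ hτ.2)

theorem sum_work_sub_work_le (S : Schedule P I) {u a b : ℝ} (hu : ∀ s ∈ P.speeds, s ≤ u)
    (ha : 0 ≤ a) (hab : a ≤ b) :
    ∑ j ∈ Finset.range I.num, (S.work j b - S.work j a) ≤ u * (b - a) := by
  have hint := fun j (_ : j ∈ Finset.range I.num) => S.intervalIntegrable_rate j ha (ha.trans hab)
  calc ∑ j ∈ Finset.range I.num, (S.work j b - S.work j a)
      = ∫ τ in a..b, ∑ j ∈ Finset.range I.num, S.rate j τ := by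
        rw [intervalIntegral.integral_finsetSum hint]
        exact Finset.sum_congr rfl fun j _ => S.work_sub_work j ha (ha.trans hab)
    _ ≤ ∫ _ in a..b, u :=
        intervalIntegral.integral_mono_on hab
          (by simpa only [Finset.sum_fn] using IntervalIntegrable.sum _ hint)
          intervalIntegrable_const fun τ _ => hu _ (S.speed_mem τ)
    _ = u * (b - a) := by rw [intervalIntegral.integral_const, smul_eq_mul, mul_comm]

theorem sum_work_le (S : Schedule P I) {u t : ℝ} (hu : ∀ s ∈ P.speeds, s ≤ u) (ht : 0 ≤ t)
    {J : Finset ℕ} (hJ : J ⊆ Finset.range I.num) : ∑ j ∈ J, S.work j t ≤ u * t := by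
  refine (Finset.sum_le_sum_of_subset_of_nonneg hJ fun j _ _ => S.work_nonneg j ht).trans ?_
  simpa only [work_zero, sub_zero] using S.sum_work_sub_work_le hu le_rfl ht

theorem work_le (S : Schedule P I) {u t : ℝ} (hu : ∀ s ∈ P.speeds, s ≤ u) (ht : 0 ≤ t) {j : ℕ}
    (hj : j < I.num) : S.work j t ≤ u * t := by
  simpa only [Finset.sum_singleton] using
    S.sum_work_le hu ht (Finset.singleton_subset_iff.2 (Finset.mem_range.2 hj))

theorem Completed.nonneg {S : Schedule P I} {j : ℕ} {t : ℝ} (h : S.Completed j t) : 0 ≤ t :=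
  (I.release_nonneg j h.1.1).trans h.1.2

theorem Completed.mono {S : Schedule P I} {j : ℕ} {t t' : ℝ} (h : S.Completed j t)
    (htt' : t ≤ t') : S.Completed j t' :=
  ⟨⟨h.1.1, h.1.2.trans htt'⟩, h.2.trans (S.work_mono j h.nonneg htt')⟩

theorem isClosed_completed_inter_Iic (S : Schedule P I) (j : ℕ) (t : ℝ) :
    IsClosed ({τ | S.Completed j τ} ∩ Iic t) := by
  by_cases hj : j < I.num ∧ 0 ≤ t
  · have heq : {τ | S.Completed j τ} ∩ Iic t =
        Icc 0 t ∩ S.work j ⁻¹' Ici (I.size j) ∩ Ici (I.release j) := by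
      ext τ
      constructor
      · exact fun h => ⟨⟨⟨h.1.nonneg, h.2⟩, h.1.2⟩, h.1.1.2⟩
      · exact fun h => ⟨⟨⟨hj.1, h.2⟩, h.1.2⟩, h.1.1.2⟩
    rw [heq]
    exact ((S.continuousOn_work j hj.2).preimage_isClosed_of_isClosed isClosed_Icc
      isClosed_Ici).inter isClosed_Ici
  · convert isClosed_empty
    exact eq_empty_of_forall_notMem fun τ h => hj ⟨h.1.1.1, h.1.nonneg.trans h.2⟩

theorem exists_first_completion (S : Schedule P I) {i : ℕ} {t : ℝ} (h : S.Completed i t) :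
    ∃ j, ∃ τ ≤ t, S.Completed j τ ∧ ∀ τ' < τ, ∀ k, ¬ S.Completed k τ' := by
  have hmem {j : ℕ} {τ : ℝ} (hτ : τ ≤ t) (hj : S.Completed j τ) :
      τ ∈ ⋃ j ∈ Finset.range I.num, {τ | S.Completed j τ} ∩ Iic t :=
    mem_biUnion (Finset.mem_coe.2 (Finset.mem_range.2 hj.1.1)) ⟨hj, hτ⟩
  have hcompact : IsCompact (⋃ j ∈ Finset.range I.num, {τ | S.Completed j τ} ∩ Iic t) :=
    (Finset.range I.num).isCompact_biUnion fun j _ =>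
      isCompact_Icc.of_isClosed_subset (S.isClosed_completed_inter_Iic j t)
        fun _ hτ => ⟨hτ.1.nonneg, hτ.2⟩
  obtain ⟨τ, hτ, hleast⟩ := hcompact.exists_isLeast ⟨t, hmem le_rfl h⟩
  obtain ⟨j, -, hj, hτt⟩ := mem_iUnion₂.1 hτ
  exact ⟨j, τ, hτt, hj, fun τ' hτ' k hk => (hleast (hmem (hτ'.le.trans hτt) hk)).not_gt hτ'⟩

theorem Completed.completionTime_le {S : Schedule P I} {j : ℕ} {t : ℝ} (h : S.Completed j t) :
    S.completionTime j ≤ ENNReal.ofReal t :=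
  iInf₂_le t h

theorem ofReal_le_completionTime {S : Schedule P I} {j : ℕ} {t : ℝ} (h : ¬ S.Completed j t) :
    ENNReal.ofReal t ≤ S.completionTime j :=
  le_iInf₂ fun _ ht' => ENNReal.ofReal_le_ofReal (not_lt.1 fun hlt => h (ht'.mono hlt.le))

theorem flow_le {S : Schedule P I} {e : ℕ → ℝ} (he : ∀ j < I.num, S.Completed j (e j)) :
    S.flow ≤ ENNReal.ofReal (∑ j ∈ Finset.range I.num, (e j - I.release j)) := by
  have hcompl := fun j (hj : j ∈ Finset.range I.num) => he j (Finset.mem_range.1 hj)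
  rw [ENNReal.ofReal_sum_of_nonneg fun j hj => sub_nonneg.2 (hcompl j hj).1.2]
  refine Finset.sum_le_sum fun j hj => ?_
  rw [ENNReal.ofReal_sub _ (I.release_nonneg j (Finset.mem_range.1 hj))]
  exact tsub_le_tsub_right (hcompl j hj).completionTime_le _

theorem makespan_le {S : Schedule P I} {M : ℝ} (hM : ∀ j < I.num, S.Completed j M) :
    S.makespan ≤ ENNReal.ofReal M :=
  iSup₂_le fun j hj => (hM j (Finset.mem_range.1 hj)).completionTime_le

theorem energy_le {S : Schedule P I} {M q : ℝ} (hM : ∀ j < I.num, S.Completed j M)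
    (hq : ∀ t, P.power (S.speed t) ≤ q) : S.energy ≤ ENNReal.ofReal (q * M) := by
  have hq0 : 0 ≤ q := (P.power_nonneg _ (S.speed_mem 0)).trans (hq 0)
  calc S.energy
      ≤ ∫⁻ _ in {t : ℝ | 0 ≤ t ∧ ENNReal.ofReal t < S.makespan}, ENNReal.ofReal q :=
        lintegral_mono fun t => ENNReal.ofReal_le_ofReal (hq t)
    _ ≤ ∫⁻ _ in Ico 0 M, ENNReal.ofReal q :=
        lintegral_mono_set fun t ht => ⟨ht.1,
          (ENNReal.ofReal_lt_ofReal_iff_of_nonneg ht.1).1 (ht.2.trans_le (makespan_le hM))⟩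
    _ = ENNReal.ofReal (q * M) := by
        rw [setLIntegral_const, Real.volume_Ico, sub_zero, ENNReal.ofReal_mul hq0]

theorem optCost_le {S : Schedule P I} {e : ℕ → ℝ} {M q : ℝ}
    (he : ∀ j < I.num, S.Completed j (e j)) (hM : ∀ j < I.num, e j ≤ M) (hM0 : 0 ≤ M)
    (hq : ∀ t, P.power (S.speed t) ≤ q) :
    optCost P I ≤
      ENNReal.ofReal (∑ j ∈ Finset.range I.num, (e j - I.release j) + q * M) := by
  have hq0 : 0 ≤ q := (P.power_nonneg _ (S.speed_mem 0)).trans (hq 0)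
  rw [ENNReal.ofReal_add (Finset.sum_nonneg fun j hj =>
    sub_nonneg.2 (he j (Finset.mem_range.1 hj)).1.2) (mul_nonneg hq0 hM0)]
  exact (iInf_le _ S).trans
    (add_le_add (flow_le he) (energy_le (fun j hj => (he j hj).mono (hM j hj)) hq))

/-- Job `j` has been released but not completed by time `t`. The flow time is the integral of the
number of active jobs. -/
def Active (S : Schedule P I) (j : ℕ) (t : ℝ) : Prop := I.Released j t ∧ ¬ S.Completed j t

theorem measurableSet_active (S : Schedule P I) (j : ℕ) : MeasurableSet {t | S.Active j t} :=
  OrdConnected.measurableSet ⟨fun _ ha _ hb _ ht =>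
    ⟨⟨ha.1.1, ha.1.2.trans ht.1⟩, fun h => hb.2 (h.mono ht.2)⟩⟩

theorem volume_active_le_jobFlow (S : Schedule P I) (j : ℕ) :
    volume {t | S.Active j t} ≤ S.jobFlow j := by
  by_cases hj : j < I.num
  · by_cases hC : S.completionTime j = ⊤
    · simp [jobFlow, hC]
    · calc volume {t | S.Active j t}
          ≤ volume (Icc (I.release j) (S.completionTime j).toReal) :=
            measure_mono fun t ht => ⟨ht.1.2,
              (ENNReal.ofReal_le_iff_le_toReal hC).1 (ofReal_le_completionTime ht.2)⟩
        _ = S.jobFlow j := by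
            rw [Real.volume_Icc, ENNReal.ofReal_sub _ (I.release_nonneg j hj),
              ENNReal.ofReal_toReal hC, jobFlow]
  · have : {t | S.Active j t} = ∅ := eq_empty_of_forall_notMem fun t ht => hj ht.1.1
    simp [this]

open Classical in
theorem ofReal_mul_le_flow (S : Schedule P I) {m a b : ℝ} (hab : a ≤ b)
    (h : ∀ t ∈ Ico a b, m ≤ #{j ∈ Finset.range I.num | S.Active j t}) :
    ENNReal.ofReal (m * (b - a)) ≤ S.flow := by
  calc ENNReal.ofReal (m * (b - a))
      = ∫⁻ _ in Ico a b, ENNReal.ofReal m := by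
        rw [setLIntegral_const, Real.volume_Ico, ENNReal.ofReal_mul' (sub_nonneg.2 hab)]
    _ ≤ ∫⁻ t in Ico a b, ∑ j ∈ Finset.range I.num, {t | S.Active j t}.indicator 1 t := by
        refine setLIntegral_mono' measurableSet_Ico fun t ht => ?_
        refine (ENNReal.ofReal_le_ofReal (h t ht)).trans_eq ?_
        simp [indicator_apply]
    _ = ∑ j ∈ Finset.range I.num, ∫⁻ t in Ico a b, {t | S.Active j t}.indicator 1 t :=
        lintegral_finsetSum _ fun j _ => measurable_one.indicator (S.measurableSet_active j)
    _ ≤ S.flow := by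
        refine Finset.sum_le_sum fun j _ => ?_
        rw [lintegral_indicator_one (S.measurableSet_active j)]
        exact (Measure.restrict_apply_le _ _).trans (S.volume_active_le_jobFlow j)

open Classical in
/-- Each job that is completed after time `T` costs at least one unit of work after time `T`. -/
theorem card_released_sub_le_card_active (S : Schedule P I) {u T t : ℝ}
    (hu : ∀ s ∈ P.speeds, s ≤ u) (hT : 0 ≤ T) (hTt : T ≤ t)
    (hsize : ∀ j < I.num, S.work j T + 1 ≤ I.size j) :
    (#{j ∈ Finset.range I.num | I.Released j t} : ℝ) - u * (t - T) ≤
      #{j ∈ Finset.range I.num | S.Active j t} := by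
  suffices h : ∀ j ∈ Finset.range I.num, (if I.Released j t then 1 else 0 : ℝ) ≤
      (if S.Active j t then 1 else 0) + (S.work j t - S.work j T) by
    have hsum := Finset.sum_le_sum h
    rw [Finset.sum_add_distrib, Finset.sum_boole, Finset.sum_boole] at hsum
    linarith [S.sum_work_sub_work_le hu hT hTt]
  intro j hj
  have hmono := S.work_mono j hT hTt
  by_cases hr : I.Released j t
  · by_cases hc : S.Completed j t
    · simp only [Active, hr, hc, if_true, not_true, and_false, if_false]
      linarith [hsize j (Finset.mem_range.1 hj), hc.2]
    · simpa [Active, hr, hc] using hmono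
  · simpa [Active, hr] using hmono

end Schedule

namespace JobSequence

/-- The job sequence with the release times of `I` and the sizes `p`: a nonclairvoyant algorithm
has to handle all of these alike as long as no job is completed. -/
def withSize (I : JobSequence) (p : ℕ → ℝ) (hp : ∀ j < I.num, 0 < p j) : JobSequence where
  __ := I
  size := p
  size_pos := hp

end JobSequence

namespace Algorithm.IsNonclairvoyant

variable {P : PowerFunction} {A : Algorithm P} {I : JobSequence} {p p' : ℕ → ℝ}
  {hp : ∀ j < I.num, 0 < p j} {hp' : ∀ j < I.num, 0 < p' j}

theorem work_eq_of_forall_not_completed (hA : A.IsNonclairvoyant) {t : ℝ} (ht : 0 ≤ t)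
    (h : ∀ τ < t, ∀ j, ¬ (A (I.withSize p hp)).Completed j τ)
    (h' : ∀ τ < t, ∀ j, ¬ (A (I.withSize p' hp')).Completed j τ) (j : ℕ) :
    (A (I.withSize p hp)).work j t = (A (I.withSize p' hp')).work j t := by
  rw [Schedule.work, Schedule.work, intervalIntegral.integral_of_le ht,
    intervalIntegral.integral_of_le ht, integral_Ioc_eq_integral_Ioo,
    integral_Ioc_eq_integral_Ioo]
  refine setIntegral_congr_fun measurableSet_Ioo fun τ hτ => hA _ _ τ ?_ j
  exact ⟨fun _ => Iff.rfl, fun _ _ => rfl,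
    fun i τ' hτ' => iff_of_false (h τ' (hτ'.trans_lt hτ.2) i) (h' τ' (hτ'.trans_lt hτ.2) i),
    fun i hi => absurd hi (h τ hτ.2 i)⟩

theorem work_eq_of_work_lt (hA : A.IsNonclairvoyant) {T : ℝ} (hT : 0 ≤ T)
    (h : ∀ j < I.num, (A (I.withSize p hp)).work j T < p j)
    (h' : ∀ j < I.num, (A (I.withSize p hp)).work j T < p' j) (j : ℕ) :
    (A (I.withSize p hp)).work j T = (A (I.withSize p' hp')).work j T := by
  set S := A (I.withSize p hp)
  set S' := A (I.withSize p' hp')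
  have hnot : ∀ τ < T, ∀ i, ¬ S.Completed i τ := fun τ hτ i hi =>
    (hi.2.trans (S.work_mono i hi.nonneg hτ.le)).not_gt (h i hi.1.1)
  refine hA.work_eq_of_forall_not_completed hT hnot (fun τ hτ i hi => ?_) j
  -- Up to its first completion, `S'` does the same work as `S`, which completes no job.
  obtain ⟨k, t, htτ, hk, hfirst⟩ := S'.exists_first_completion hi
  have htT : t < T := htτ.trans_lt hτ
  have hwork : S.work k t = S'.work k t := hA.work_eq_of_forall_not_completed hk.nonneg
    (fun τ' hτ' => hnot τ' (hτ'.trans htT)) hfirst k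
  have hle : p' k ≤ S.work k t := hwork ▸ hk.2
  exact (hle.trans (S.work_mono k hk.nonneg htT.le)).not_gt (h' k hk.1.1)

/-- The adversary: run `A` on jobs too large to be completed by time `T`, and then cut each of them
down to one unit more than the work `A` has done on it. -/
theorem exists_size_eq_work_add_one (hA : A.IsNonclairvoyant) (I : JobSequence) {u T : ℝ}
    (hu : ∀ s ∈ P.speeds, s ≤ u) (hT : 0 ≤ T) :
    ∃ (p : ℕ → ℝ) (hp : ∀ j < I.num, 0 < p j),
      ∀ j, p j = (A (I.withSize p hp)).work j T + 1 := by
  have hu0 : 0 ≤ u := hu 0 P.zero_mem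
  set S := A (I.withSize (fun _ => u * T + 1) fun _ _ => by positivity)
  have hp : ∀ j < I.num, 0 < S.work j T + 1 := fun j _ => by linarith [S.work_nonneg j hT]
  refine ⟨fun j => S.work j T + 1, hp, fun j => congrArg (· + 1) ?_⟩
  exact hA.work_eq_of_work_lt hT (fun i hi => (S.work_le hu hT hi).trans_lt (lt_add_one _))
    (fun i _ => lt_add_one _) j

end Algorithm.IsNonclairvoyant

theorem integral_indicator_Ico_const {a b c t : ℝ} (ht : 0 ≤ t) :
    ∫ τ in (0 : ℝ)..t, (Ico a b).indicator (fun _ => c) τ =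
      volume.real (Ioc 0 t ∩ Ico a b) * c := by
  rw [intervalIntegral.integral_of_le ht, setIntegral_indicator measurableSet_Ico,
    setIntegral_const, smul_eq_mul]

theorem sum_indicator_const_eq_zero_or_self {α ι : Type*} {s : Finset ι} {B : ι → Set α}
    (hB : (s : Set ι).PairwiseDisjoint B) (c : ℝ) (x : α) :
    ∑ i ∈ s, (B i).indicator (fun _ => c) x = 0 ∨ ∑ i ∈ s, (B i).indicator (fun _ => c) x = c := by
  rw [← Finset.indicator_biUnion_apply _ _ hB]
  exact indicator_eq_zero_or_self _ _ _

namespace Schedule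

/-- The schedule that runs each job `j` without interruption at speed `v` from time `start j` on,
and idles when no job is running. -/
noncomputable def sequential (P : PowerFunction) (I : JobSequence) (v : ℝ) (start : ℕ → ℝ)
    (hv : 0 < v) (hvP : v ∈ P.speeds) (hstart : ∀ j < I.num, I.release j ≤ start j)
    (hdisj : (Finset.range I.num : Set ℕ).PairwiseDisjoint
      fun j => Ico (start j) (start j + I.size j / v)) : Schedule P I where
  rate j t :=
    if j < I.num then (Ico (start j) (start j + I.size j / v)).indicator (fun _ => v) t else 0
  rate_nonneg j t := by
    split_ifs
    · exact indicator_nonneg (fun _ _ => hv.le) t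
    · rfl
  rate_integrable j t _ := by
    split_ifs
    · exact ((integrable_indicator_iff measurableSet_Ico).2
        (integrableOn_const (by simp))).intervalIntegrable
    · exact intervalIntegrable_const
  rate_eq_zero j t h := by
    split_ifs with hj
    · exact indicator_of_notMem (fun ht => h ⟨hj, (hstart j hj).trans ht.1⟩) _
    · rfl
  speed_mem t := by
    rw [Finset.sum_congr rfl fun j hj => if_pos (Finset.mem_range.1 hj)]
    rcases sum_indicator_const_eq_zero_or_self hdisj v t with h | h <;> rw [h]
    exacts [P.zero_mem, hvP]
  work_le_size j hj t ht := by
    have hsize : 0 ≤ I.size j / v := (div_pos (I.size_pos j hj) hv).le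
    simp only [if_pos hj]
    rw [integral_indicator_Ico_const ht, ← le_div_iff₀ hv]
    refine (measureReal_mono inter_subset_right (by simp)).trans_eq ?_
    rw [Real.volume_real_Ico_of_le (le_add_of_nonneg_right hsize), add_sub_cancel_left]

section sequential

variable {P : PowerFunction} {I : JobSequence} {v : ℝ} {start : ℕ → ℝ} {hv : 0 < v}
  {hvP : v ∈ P.speeds} {hstart : ∀ j < I.num, I.release j ≤ start j}
  {hdisj : (Finset.range I.num : Set ℕ).PairwiseDisjoint
    fun j => Ico (start j) (start j + I.size j / v)}

theorem speed_sequential_eq_zero_or_self (t : ℝ) :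
    (sequential P I v start hv hvP hstart hdisj).speed t = 0 ∨
      (sequential P I v start hv hvP hstart hdisj).speed t = v := by
  simp only [speed, sequential]
  rw [Finset.sum_congr rfl fun j hj => if_pos (Finset.mem_range.1 hj)]
  exact sum_indicator_const_eq_zero_or_self hdisj v t

theorem completed_sequential {j : ℕ} (hj : j < I.num) :
    (sequential P I v start hv hvP hstart hdisj).Completed j (start j + I.size j / v) := by
  have hstart0 : 0 ≤ start j := (I.release_nonneg j hj).trans (hstart j hj)
  have hsize : start j ≤ start j + I.size j / v :=
    le_add_of_nonneg_right (div_pos (I.size_pos j hj) hv).le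
  refine ⟨⟨hj, (hstart j hj).trans hsize⟩, ?_⟩
  simp only [work, sequential, if_pos hj]
  rw [integral_indicator_Ico_const (hstart0.trans hsize), ← div_le_iff₀ hv]
  calc I.size j / v = volume.real (Ioo (start j) (start j + I.size j / v)) := by
        rw [Real.volume_real_Ioo_of_le hsize, add_sub_cancel_left]
    _ ≤ volume.real (Ioc 0 (start j + I.size j / v) ∩ Ico (start j) (start j + I.size j / v)) :=
        measureReal_mono (fun t ht => ⟨⟨hstart0.trans_lt ht.1, ht.2.le⟩, ht.1.le, ht.2⟩)
          (measure_ne_top_of_subset inter_subset_right (by simp))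

end sequential

end Schedule

theorem optCost_le_of_sequential {P : PowerFunction} {I : JobSequence} {v M : ℝ} {start : ℕ → ℝ}
    (hv : 0 < v) (hvP : v ∈ P.speeds) (hstart : ∀ j < I.num, I.release j ≤ start j)
    (hdisj : (Finset.range I.num : Set ℕ).PairwiseDisjoint
      fun j => Ico (start j) (start j + I.size j / v))
    (hM : ∀ j < I.num, start j + I.size j / v ≤ M) (hM0 : 0 ≤ M) :
    optCost P I ≤ ENNReal.ofReal
      (∑ j ∈ Finset.range I.num, (start j + I.size j / v - I.release j) +
        (P.power 0 + P.power v) * M) := by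
  refine Schedule.optCost_le (S := Schedule.sequential P I v start hv hvP hstart hdisj)
    (fun j hj => Schedule.completed_sequential hj) hM hM0 fun t => ?_
  rcases Schedule.speed_sequential_eq_zero_or_self t with h | h <;> rw [h]
  · exact le_add_of_nonneg_right (P.power_nonneg v hvP)
  · exact le_add_of_nonneg_left (P.power_nonneg 0 P.zero_mem)

/-- A batch of `n` jobs released at time `0`, followed by a stream of `K` jobs released at the times
`T, T + 1 / v, T + 2 / v, …`, all of size `1`. -/
noncomputable def batchThenStream (n K : ℕ) (T v : ℝ) (hT : 0 ≤ T) (hv : 0 < v) :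
    JobSequence where
  num := n + K
  release j := if j < n then 0 else T + (j - n) / v
  size _ := 1
  release_nonneg j _ := by
    split_ifs with hj
    · rfl
    · have : (n : ℝ) ≤ j := Nat.cast_le.2 (not_lt.1 hj)
      exact add_nonneg hT (div_nonneg (sub_nonneg.2 this) hv.le)
  release_mono i j hij _ := by
    by_cases hj : j < n
    · simp [hj, hij.trans_lt hj]
    by_cases hi : i < n
    · have : (n : ℝ) ≤ j := Nat.cast_le.2 (not_lt.1 hj)
      simpa only [hi, hj, if_true, if_false] using
        add_nonneg hT (div_nonneg (sub_nonneg.2 this) hv.le)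
    · simp only [hi, hj, if_false]
      gcongr
  size_pos _ _ := one_pos

section batchThenStream

variable {n K : ℕ} {T v : ℝ} {hT : 0 ≤ T} {hv : 0 < v} {P : PowerFunction} {p : ℕ → ℝ}
  {hp : ∀ j < (batchThenStream n K T v hT hv).num, 0 < p j}

theorem not_released_batchThenStream {j : ℕ} (hj : n ≤ j) {t : ℝ} (ht : t < T) :
    ¬ (batchThenStream n K T v hT hv).Released j t := by
  rintro ⟨-, hr⟩
  have hjn : 0 ≤ ((j : ℝ) - n) / v := div_nonneg (sub_nonneg.2 (Nat.cast_le.2 hj)) hv.le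
  simp only [batchThenStream, hj.not_gt, if_false] at hr
  linarith

open Classical in
theorem le_card_released_batchThenStream {t : ℝ} (ht : t ∈ Icc T (T + K / v)) :
    n + v * (t - T) ≤
      #{j ∈ Finset.range (n + K) | (batchThenStream n K T v hT hv).Released j t} := by
  have hK : ⌈v * (t - T)⌉₊ ≤ K := by
    rw [Nat.ceil_le, ← le_div_iff₀' hv]
    linarith [ht.2]
  have hsub : Finset.range (n + ⌈v * (t - T)⌉₊) ⊆
      {j ∈ Finset.range (n + K) | (batchThenStream n K T v hT hv).Released j t} := by
    intro j hj
    rw [Finset.mem_range] at hj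
    have hjK : j < n + K := by omega
    refine Finset.mem_filter.2 ⟨Finset.mem_range.2 hjK, hjK, ?_⟩
    simp only [batchThenStream]
    split_ifs with hjn
    · exact hT.trans ht.1
    · have hlt : j - n < ⌈v * (t - T)⌉₊ := by omega
      rw [Nat.lt_ceil, Nat.cast_sub (not_lt.1 hjn)] at hlt
      rw [← le_sub_iff_add_le', div_le_iff₀' hv]
      exact hlt.le
  calc (n : ℝ) + v * (t - T) ≤ n + ⌈v * (t - T)⌉₊ := by gcongr; exact Nat.le_ceil _
    _ = ((n + ⌈v * (t - T)⌉₊ : ℕ) : ℝ) := (Nat.cast_add _ _).symm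
    _ ≤ _ := Nat.cast_le.2 ((Finset.card_range _).symm.trans_le (Finset.card_le_card hsub))

/-- Even at the top speed `u`, the number of active jobs decreases only at rate `u - v` while the
stream lasts. -/
theorem ofReal_mul_le_flow_batchThenStream
    (S : Schedule P ((batchThenStream n K T v hT hv).withSize p hp)) {u : ℝ}
    (hu : ∀ s ∈ P.speeds, s ≤ u) (hvu : v ≤ u) (hsize : ∀ j < n + K, S.work j T + 1 ≤ p j) :
    ENNReal.ofReal ((n - (u - v) * (K / v)) * (K / v)) ≤ S.flow := by
  classical
  have hKv : (0 : ℝ) ≤ K / v := by positivity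
  have hactive : ∀ t ∈ Ico T (T + K / v), n - (u - v) * (K / v) ≤
      #{j ∈ Finset.range (n + K) | S.Active j t} := by
    intro t ht
    have hrel := le_card_released_batchThenStream (n := n) (hT := hT) (hv := hv)
      (Ico_subset_Icc_self ht)
    have hact := S.card_released_sub_le_card_active hu hT ht.1 hsize
    have hloss : (u - v) * (t - T) ≤ (u - v) * (K / v) :=
      mul_le_mul_of_nonneg_left (by linarith [ht.2]) (sub_nonneg.2 hvu)
    calc n - (u - v) * (K / v) ≤ n + v * (t - T) - u * (t - T) := by linarith
      _ ≤ _ := (sub_le_sub_right hrel _).trans hact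
  simpa only [add_sub_cancel_left] using
    S.ofReal_mul_le_flow (le_add_of_nonneg_right hKv) hactive

end batchThenStream

/-- Start times at speed `v` of the jobs of `batchThenStream n K T v` with sizes `p`, when job `l`
is postponed until the end: the rest of the batch is processed one job after the other from time
`0` on, and the jobs of the stream are started on release. -/
noncomputable def postponingStart (n K : ℕ) (T v : ℝ) (p : ℕ → ℝ) (l j : ℕ) : ℝ :=
  if j = l then T + K / v
  else if j < n then (∑ i ∈ (Finset.range j).erase l, p i) / v
  else T + (j - n) / v

section postponingStart

variable {n K l : ℕ} {T v : ℝ} {p : ℕ → ℝ}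

theorem postponingStart_self : postponingStart n K T v p l l = T + K / v :=
  if_pos rfl

theorem postponingStart_of_lt {j : ℕ} (hjl : j ≠ l) (hjn : j < n) :
    postponingStart n K T v p l j = (∑ i ∈ (Finset.range j).erase l, p i) / v := by
  rw [postponingStart, if_neg hjl, if_pos hjn]

theorem postponingStart_of_le {j : ℕ} (hjl : j ≠ l) (hnj : n ≤ j) :
    postponingStart n K T v p l j = T + (j - n) / v := by
  rw [postponingStart, if_neg hjl, if_neg hnj.not_gt]

theorem postponingStart_add_le_sum_div (hv : 0 < v) (hp : ∀ j < n, 0 ≤ p j) {i j : ℕ}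
    (hil : i ≠ l) (hij : i < j) (hjn : j ≤ n) :
    postponingStart n K T v p l i + p i / v ≤ (∑ k ∈ (Finset.range j).erase l, p k) / v := by
  rw [postponingStart_of_lt hil (hij.trans_le hjn), ← add_div]
  gcongr
  rw [add_comm, ← Finset.sum_insert (by simp)]
  refine Finset.sum_le_sum_of_subset_of_nonneg ?_ fun k hk _ =>
    hp k ((Finset.mem_range.1 (Finset.mem_of_mem_erase hk)).trans_le hjn)
  intro k hk
  rcases Finset.mem_insert.1 hk with rfl | hk
  · simp [hil, hij]
  · simp only [Finset.mem_erase, Finset.mem_range] at hk ⊢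
    exact ⟨hk.1, hk.2.trans hij⟩

theorem postponingStart_add_le_of_lt (hv : 0 < v) (hp : ∀ j < n, 0 ≤ p j)
    (hsum : ∑ i ∈ (Finset.range n).erase l, p i ≤ v * T) {j : ℕ} (hjl : j ≠ l) (hjn : j < n) :
    postponingStart n K T v p l j + p j / v ≤ T :=
  (postponingStart_add_le_sum_div hv hp hjl hjn le_rfl).trans ((div_le_iff₀' hv).2 hsum)

theorem postponingStart_add_eq_of_le (hone : ∀ j, n ≤ j → p j = 1) {j : ℕ} (hjl : j ≠ l)
    (hnj : n ≤ j) :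
    postponingStart n K T v p l j + p j / v = T + (j + 1 - n) / v := by
  rw [postponingStart_of_le hjl hnj, hone j hnj]
  ring

theorem postponingStart_add_le_postponingStart_self (hv : 0 < v) (hp : ∀ j < n, 0 ≤ p j)
    (hone : ∀ j, n ≤ j → p j = 1) (hsum : ∑ i ∈ (Finset.range n).erase l, p i ≤ v * T) {j : ℕ}
    (hjl : j ≠ l) (hj : j < n + K) :
    postponingStart n K T v p l j + p j / v ≤ postponingStart n K T v p l l := by
  rw [postponingStart_self]
  by_cases hjn : j < n
  · exact (postponingStart_add_le_of_lt hv hp hsum hjl hjn).trans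
      (le_add_of_nonneg_right (by positivity))
  · rw [postponingStart_add_eq_of_le hone hjl (not_lt.1 hjn)]
    have : (j : ℝ) + 1 ≤ n + K := by exact_mod_cast hj
    gcongr
    linarith

theorem postponingStart_add_le_postponingStart (hv : 0 < v) (hp : ∀ j < n, 0 ≤ p j)
    (hone : ∀ j, n ≤ j → p j = 1) (hsum : ∑ i ∈ (Finset.range n).erase l, p i ≤ v * T)
    {i j : ℕ} (hil : i ≠ l) (hjl : j ≠ l) (hij : i < j) :
    postponingStart n K T v p l i + p i / v ≤ postponingStart n K T v p l j := by
  by_cases hjn : j < n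
  · rw [postponingStart_of_lt hjl hjn]
    exact postponingStart_add_le_sum_div hv hp hil hij hjn.le
  have hjn' : (n : ℝ) ≤ j := Nat.cast_le.2 (not_lt.1 hjn)
  rw [postponingStart_of_le hjl (not_lt.1 hjn)]
  by_cases hin : i < n
  · exact (postponingStart_add_le_of_lt hv hp hsum hil hin).trans
      (le_add_of_nonneg_right (div_nonneg (sub_nonneg.2 hjn') hv.le))
  · rw [postponingStart_add_eq_of_le hone hil (not_lt.1 hin)]
    have : (i : ℝ) + 1 ≤ j := by exact_mod_cast hij
    gcongr

theorem pairwiseDisjoint_postponingStart (hv : 0 < v) (hp : ∀ j < n, 0 ≤ p j)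
    (hone : ∀ j, n ≤ j → p j = 1) (hsum : ∑ i ∈ (Finset.range n).erase l, p i ≤ v * T) :
    (Finset.range (n + K) : Set ℕ).PairwiseDisjoint fun j =>
      Ico (postponingStart n K T v p l j) (postponingStart n K T v p l j + p j / v) := by
  intro i hi j hj hij
  rw [Finset.mem_coe, Finset.mem_range] at hi hj
  refine Ico_disjoint_Ico.2 ?_
  rw [min_le_iff, le_max_iff, le_max_iff]
  by_cases hil : i = l
  · subst hil
    exact .inr (.inl (postponingStart_add_le_postponingStart_self hv hp hone hsum hij.symm hj))
  by_cases hjl : j = l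
  · subst hjl
    exact .inl (.inr (postponingStart_add_le_postponingStart_self hv hp hone hsum hij hi))
  rcases hij.lt_or_gt with hlt | hlt
  · exact .inl (.inr (postponingStart_add_le_postponingStart hv hp hone hsum hil hjl hlt))
  · exact .inr (.inl (postponingStart_add_le_postponingStart hv hp hone hsum hjl hil hlt))

theorem release_le_postponingStart (hT : 0 ≤ T) (hv : 0 < v) (hp : ∀ j < n, 0 ≤ p j) {j : ℕ}
    (hj : j < n + K) :
    (batchThenStream n K T v hT hv).release j ≤ postponingStart n K T v p l j := by
  have hjK : (j : ℝ) - n ≤ K := by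
    rw [sub_le_iff_le_add']
    exact_mod_cast hj.le
  simp only [batchThenStream]
  by_cases hjl : j = l
  · rw [hjl, postponingStart_self, ← hjl]
    split_ifs
    · positivity
    · gcongr
  by_cases hjn : j < n
  · rw [if_pos hjn, postponingStart_of_lt hjl hjn]
    refine div_nonneg (Finset.sum_nonneg fun i hi => hp i ?_) hv.le
    exact (Finset.mem_range.1 (Finset.mem_of_mem_erase hi)).trans hjn
  · rw [if_neg hjn, postponingStart_of_le hjl (not_lt.1 hjn)]

theorem postponingStart_add_sub_release_le (hT : 0 ≤ T) (hv : 0 < v) (hp : ∀ j < n, 0 ≤ p j)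
    (hone : ∀ j, n ≤ j → p j = 1) (hsum : ∑ i ∈ (Finset.range n).erase l, p i ≤ v * T) (j : ℕ) :
    postponingStart n K T v p l j + p j / v - (batchThenStream n K T v hT hv).release j ≤
      (if j < n then T else 1 / v) + if j = l then (K + p l) / v else 0 := by
  simp only [batchThenStream]
  by_cases hjl : j = l
  · subst hjl
    have hfirst : 0 ≤ if j < n then T else 1 / v := by split_ifs <;> positivity
    rw [postponingStart_self, if_pos rfl, add_div]
    split_ifs with hjn
    · linarith
    · have : 0 ≤ ((j : ℝ) - n) / v :=
        div_nonneg (sub_nonneg.2 (Nat.cast_le.2 (not_lt.1 hjn))) hv.le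
      rw [if_neg hjn] at hfirst
      linarith
  rw [if_neg hjl, add_zero]
  split_ifs with hjn
  · rw [sub_zero]
    exact postponingStart_add_le_of_lt hv hp hsum hjl hjn
  · rw [postponingStart_add_eq_of_le hone hjl (not_lt.1 hjn)]
    exact le_of_eq (by ring)

end postponingStart

theorem optCost_batchThenStream_le {n K l : ℕ} {T v : ℝ} {p : ℕ → ℝ} {P : PowerFunction}
    (hT : 0 ≤ T) (hv : 0 < v) {hp : ∀ j < (batchThenStream n K T v hT hv).num, 0 < p j}
    (hvP : v ∈ P.speeds) (hl : l < n + K) (hone : ∀ j, n ≤ j → p j = 1)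
    (hsum : ∑ j ∈ (Finset.range n).erase l, p j ≤ v * T) :
    optCost P ((batchThenStream n K T v hT hv).withSize p hp) ≤
      ENNReal.ofReal (n * T + K / v + (K + p l) / v +
        (P.power 0 + P.power v) * (T + (K + p l) / v)) := by
  set I := (batchThenStream n K T v hT hv).withSize p hp
  have hp0 : ∀ j < n, 0 ≤ p j := fun j hj => (hp j (hj.trans_le (Nat.le_add_right n K))).le
  have hpl : 0 < p l := hp l hl
  have hstart : ∀ j < I.num, I.release j ≤ postponingStart n K T v p l j := fun _ hj =>
    release_le_postponingStart hT hv hp0 hj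
  have hend_self : postponingStart n K T v p l l + p l / v = T + (K + p l) / v := by
    rw [postponingStart_self]; ring
  have hend : ∀ j < I.num, postponingStart n K T v p l j + p j / v ≤ T + (K + p l) / v := by
    intro j hj
    rw [← hend_self]
    by_cases hjl : j = l
    · rw [hjl]
    · exact (postponingStart_add_le_postponingStart_self hv hp0 hone hsum hjl hj).trans
        (le_add_of_nonneg_right (by positivity))
  have hflow : ∑ j ∈ Finset.range I.num,
      (postponingStart n K T v p l j + p j / v - I.release j) ≤
        n * T + K / v + (K + p l) / v :=
    calc ∑ j ∈ Finset.range I.num, (postponingStart n K T v p l j + p j / v - I.release j)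
        ≤ ∑ j ∈ Finset.range (n + K),
            ((if j < n then T else 1 / v) + if j = l then (K + p l) / v else 0) :=
          Finset.sum_le_sum fun j _ => postponingStart_add_sub_release_le hT hv hp0 hone hsum j
      _ = n * T + K / v + (K + p l) / v := by
          rw [Finset.sum_add_distrib, Finset.sum_ite_eq', if_pos (Finset.mem_range.2 hl),
            Finset.sum_range_add, Finset.sum_congr rfl fun j hj => if_pos (Finset.mem_range.1 hj)]
          simp [div_eq_mul_inv]
  refine (optCost_le_of_sequential hv hvP hstart
    (pairwiseDisjoint_postponingStart hv hp0 hone hsum) hend (by positivity)).trans ?_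
  exact ENNReal.ofReal_le_ofReal (add_le_add_left hflow _)

theorem exists_sum_erase_le {ι : Type*} [DecidableEq ι] {s : Finset ι} (hs : s.Nonempty)
    (f : ι → ℝ) : ∃ i ∈ s, ∑ j ∈ s.erase i, f j ≤ (1 - 1 / #s) * ∑ j ∈ s, f j := by
  have hcard : (#s : ℝ) ≠ 0 := Nat.cast_ne_zero.2 hs.card_ne_zero
  obtain ⟨i, hi, hle⟩ := Finset.exists_le_of_sum_le (f := fun _ => (∑ j ∈ s, f j) / #s) (g := f) hs
    (by rw [Finset.sum_const, nsmul_eq_mul, mul_div_cancel₀ _ hcard])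
  refine ⟨i, hi, ?_⟩
  rw [Finset.sum_erase_eq_sub hi, one_sub_mul, one_div_mul_eq_div]
  exact sub_le_sub_left hle _

section estimates

variable {n u v q E : ℝ}

theorem half_le_of_sub_mul_le (hn : 1 ≤ n) (hvu : v ≤ u) (hδ : (u - v) * (4 * n ^ 2) ≤ u) :
    u / 2 ≤ v := by
  have : u - v ≤ (u - v) * n ^ 2 := le_mul_of_one_le_right (sub_nonneg.2 hvu) (one_le_pow₀ hn)
  linarith

theorem pow_four_div_le_mul (hn : 1 ≤ n) (hu : 0 < u) (hvu : v ≤ u)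
    (hδ : (u - v) * (4 * n ^ 2) ≤ u) :
    n ^ 4 / (2 * u) ≤ (n - (u - v) * (n ^ 3 / v)) * (n ^ 3 / v) := by
  have huv : u / 2 ≤ v := half_le_of_sub_mul_le hn hvu hδ
  have hv : 0 < v := (half_pos hu).trans_le huv
  have hloss : (u - v) * (n ^ 3 / v) ≤ n / 2 := by
    rw [← mul_div_assoc, div_le_iff₀ hv]
    calc (u - v) * n ^ 3 = (u - v) * (4 * n ^ 2) * n / 4 := by ring
      _ ≤ u * n / 4 := by gcongr
      _ = n / 2 * (u / 2) := by ring
      _ ≤ n / 2 * v := by gcongr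
  calc n ^ 4 / (2 * u) = n / 2 * (n ^ 3 / u) := by field_simp
    _ ≤ (n - (u - v) * (n ^ 3 / v)) * (n ^ 3 / v) := by
        refine mul_le_mul ?_ ?_ (by positivity) ?_
        · linarith
        · gcongr
        · linarith

theorem one_sub_one_div_mul_le (hn : 1 ≤ n) (hu : 0 < u) (hδ : (u - v) * (4 * n ^ 2) ≤ u) :
    (1 - 1 / n) * (2 * n ^ 2 + n) ≤ v * (2 * n ^ 2 / u) := by
  have hloss : (u - v) * (2 * n ^ 2 / u) ≤ 1 / 2 := by
    rw [← mul_div_assoc, div_le_iff₀ hu]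
    linarith
  calc (1 - 1 / n) * (2 * n ^ 2 + n) = 2 * n ^ 2 - n - 1 := by
        field_simp
        ring
    _ ≤ 2 * n ^ 2 - (u - v) * (2 * n ^ 2 / u) := by linarith
    _ = v * (2 * n ^ 2 / u) := by
        field_simp
        ring

theorem postponing_cost_le (hn : 1 ≤ n) (hu : 0 < u) (huv : u / 2 ≤ v) (hq : q ≤ 2 * n ^ 2 + 1)
    (hE : 0 ≤ E) :
    n * (2 * n ^ 2 / u) + n ^ 3 / v + (n ^ 3 + q) / v +
      E * (2 * n ^ 2 / u + (n ^ 3 + q) / v) ≤ 12 * (1 + E) * n ^ 3 / u := by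
  have hn2 : n ^ 2 ≤ n ^ 3 := pow_le_pow_right₀ hn (by norm_num)
  have hn3 : 1 ≤ n ^ 3 := one_le_pow₀ hn
  have hstream : n ^ 3 / v ≤ 2 * n ^ 3 / u := by
    calc n ^ 3 / v ≤ n ^ 3 / (u / 2) := by gcongr
      _ = 2 * n ^ 3 / u := by field_simp
  have hlast : (n ^ 3 + q) / v ≤ 8 * n ^ 3 / u := by
    calc (n ^ 3 + q) / v ≤ (4 * n ^ 3) / (u / 2) := by
          gcongr
          linarith
      _ = 8 * n ^ 3 / u := by field_simp; norm_num
  have hbatch : 2 * n ^ 2 / u ≤ 2 * n ^ 3 / u := by gcongr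
  calc _ ≤ n * (2 * n ^ 2 / u) + 2 * n ^ 3 / u + 8 * n ^ 3 / u +
        E * (2 * n ^ 3 / u + 8 * n ^ 3 / u) := by gcongr
    _ = (12 + 10 * E) * n ^ 3 / u := by ring
    _ ≤ 12 * (1 + E) * n ^ 3 / u := by
        gcongr
        linarith

end estimates

namespace Algorithm

variable {P : PowerFunction} {A : Algorithm P} {u v : ℝ}

theorem IsNonclairvoyant.exists_flow_ge_optCost_le (hA : A.IsNonclairvoyant)
    (hu : ∀ s ∈ P.speeds, s ≤ u) (hu0 : 0 < u) (hvP : v ∈ P.speeds) {n : ℕ} (hn : 0 < n)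
    (hδ : (u - v) * (4 * n ^ 2) ≤ u) :
    ∃ I : JobSequence, ENNReal.ofReal (n ^ 4 / (2 * u)) ≤ (A I).flow ∧
      optCost P I ≤ ENNReal.ofReal (12 * (1 + (P.power 0 + P.power v)) * n ^ 3 / u) := by
  have hn1 : (1 : ℝ) ≤ n := Nat.one_le_cast.2 hn
  have hvu : v ≤ u := hu v hvP
  have huv : u / 2 ≤ v := half_le_of_sub_mul_le hn1 hvu hδ
  have hv : 0 < v := (half_pos hu0).trans_le huv
  set T : ℝ := 2 * n ^ 2 / u
  have hT : 0 ≤ T := by positivity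
  have huT : u * T = 2 * n ^ 2 := mul_div_cancel₀ _ hu0.ne'
  obtain ⟨p, hp, hpx⟩ := hA.exists_size_eq_work_add_one (batchThenStream n (n ^ 3) T v hT hv) hu hT
  set I := (batchThenStream n (n ^ 3) T v hT hv).withSize p hp
  have hone : ∀ j, n ≤ j → p j = 1 := fun j hj => by
    rw [hpx, (A I).work_eq_zero hT fun τ hτ =>
      not_released_batchThenStream (hT := hT) (hv := hv) hj hτ, zero_add]
  have hnum : Finset.range n ⊆ Finset.range I.num := Finset.range_mono (Nat.le_add_right n _)
  have htotal : ∑ j ∈ Finset.range n, p j ≤ 2 * n ^ 2 + n := by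
    simpa only [hpx, Finset.sum_add_distrib, Finset.sum_const, Finset.card_range, nsmul_one, huT]
      using add_le_add_left ((A I).sum_work_le hu hT hnum) (n : ℝ)
  obtain ⟨l, hl, hlavg⟩ := exists_sum_erase_le (Finset.nonempty_range_iff.2 hn.ne') p
  rw [Finset.card_range] at hlavg
  have hsum : ∑ j ∈ (Finset.range n).erase l, p j ≤ v * T :=
    calc ∑ j ∈ (Finset.range n).erase l, p j ≤ (1 - 1 / n) * ∑ j ∈ Finset.range n, p j := hlavg
      _ ≤ (1 - 1 / n) * (2 * n ^ 2 + n) := mul_le_mul_of_nonneg_left htotal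
          (sub_nonneg.2 (div_le_one_of_le₀ hn1 n.cast_nonneg))
      _ ≤ v * T := one_sub_one_div_mul_le hn1 hu0 hδ
  have hlI : l < I.num := Finset.mem_range.1 (hnum hl)
  have hpl : p l ≤ 2 * n ^ 2 + 1 := by
    rw [hpx, ← huT]
    gcongr
    exact (A I).work_le hu hT hlI
  have hflow := ofReal_mul_le_flow_batchThenStream (A I) hu hvu fun j _ => (hpx j).ge
  have hopt := optCost_batchThenStream_le hT hv (hp := hp) hvP hlI hone hsum
  push_cast at hflow hopt
  refine ⟨I, le_trans ?_ hflow, hopt.trans ?_⟩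
  · exact ENNReal.ofReal_le_ofReal (pow_four_div_le_mul hn1 hu0 hvu hδ)
  · exact ENNReal.ofReal_le_ofReal (postponing_cost_le hn1 hu0 huv hpl
      (add_nonneg (P.power_nonneg 0 P.zero_mem) (P.power_nonneg v hvP)))

theorem IsCompetitive.natCast_le {c : ℝ≥0} (hc : A.IsCompetitive c) (hA : A.IsNonclairvoyant)
    (hu : ∀ s ∈ P.speeds, s ≤ u) (hu0 : 0 < u) (hvP : v ∈ P.speeds) {n : ℕ}
    (hδ : (u - v) * (4 * n ^ 2) ≤ u) :
    (n : ℝ) ≤ 24 * c * (1 + (P.power 0 + P.power v)) := by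
  have hE : 0 ≤ P.power 0 + P.power v :=
    add_nonneg (P.power_nonneg 0 P.zero_mem) (P.power_nonneg v hvP)
  rcases n.eq_zero_or_pos with rfl | hn
  · rw [Nat.cast_zero]
    positivity
  obtain ⟨I, hflow, hopt⟩ := hA.exists_flow_ge_optCost_le hu hu0 hvP hn hδ
  have hratio : (n : ℝ) ^ 4 / (2 * u) ≤
      c * (12 * (1 + (P.power 0 + P.power v)) * n ^ 3 / u) := by
    rw [← ENNReal.ofReal_le_ofReal_iff (by positivity), ENNReal.ofReal_mul c.coe_nonneg,
      ENNReal.ofReal_coe_nnreal]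
    calc _ ≤ (A I).flow := hflow
      _ ≤ (A I).cost := le_self_add
      _ ≤ c * optCost P I := hc I
      _ ≤ _ := by gcongr
  have hpos : (0 : ℝ) < n ^ 3 / (2 * u) := by positivity
  refine le_of_mul_le_mul_right ?_ hpos
  calc (n : ℝ) * (n ^ 3 / (2 * u)) = n ^ 4 / (2 * u) := by ring
    _ ≤ c * (12 * (1 + (P.power 0 + P.power v)) * n ^ 3 / u) := hratio
    _ = 24 * c * (1 + (P.power 0 + P.power v)) * (n ^ 3 / (2 * u)) := by ring

theorem IsCompetitive.inv_sqrt_sub_le {c : ℝ≥0} (hc : A.IsCompetitive c)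
    (hA : A.IsNonclairvoyant) (hu : ∀ s ∈ P.speeds, s ≤ u) (hvP : v ∈ P.speeds) (hvu : v < u) :
    (√(u - v))⁻¹ ≤ 2 / √u * (24 * c * (1 + (P.power 0 + P.power v)) + 1) := by
  have hu0 : 0 < u := (P.speeds_nonneg v hvP).trans_lt hvu
  have huv : 0 < u - v := sub_pos.2 hvu
  set n := ⌊√u / (2 * √(u - v))⌋₊
  have hn : (n : ℝ) * (2 * √(u - v)) ≤ √u :=
    (le_div_iff₀ (by positivity)).1 (Nat.floor_le (by positivity))
  have hδ : (u - v) * (4 * n ^ 2) ≤ u :=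
    calc (u - v) * (4 * n ^ 2) = (n * (2 * √(u - v))) ^ 2 := by
          rw [mul_pow, mul_pow, Real.sq_sqrt huv.le]
          ring
      _ ≤ √u ^ 2 := by gcongr
      _ = u := Real.sq_sqrt hu0.le
  calc (√(u - v))⁻¹ = 2 / √u * (√u / (2 * √(u - v))) := by field_simp
    _ ≤ 2 / √u * (n + 1) := by
        gcongr
        exact (Nat.lt_floor_add_one _).le
    _ ≤ _ := by
        gcongr
        exact hc.natCast_le hA hu hu0 hvP hδ

end Algorithm

theorem not_isCompetitive_of_isLittleO {P : PowerFunction} {A : Algorithm P} {u : ℝ}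
    (hA : A.IsNonclairvoyant) (hu : IsLUB P.speeds u) (hmem : u ∉ P.speeds)
    (hP : P.power =o[𝓝[P.speeds] u] fun s => (√(u - s))⁻¹) (c : ℝ≥0) : ¬ A.IsCompetitive c := by
  intro hc
  have hne : (𝓝[P.speeds] u).NeBot := hu.nhdsWithin_neBot ⟨0, P.zero_mem⟩
  have hlt : ∀ s ∈ P.speeds, s < u := fun s hs => (hu.1 hs).lt_of_ne (hs.ne_of_notMem hmem)
  have hpos : ∀ s ∈ P.speeds, 0 < √(u - s) := fun s hs => Real.sqrt_pos.2 (sub_pos.2 (hlt s hs))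
  have htop : Tendsto (fun s => (√(u - s))⁻¹) (𝓝[P.speeds] u) atTop := by
    have hcont : ContinuousWithinAt (fun s => √(u - s)) P.speeds u := by fun_prop
    refine Tendsto.inv_tendsto_nhdsGT_zero (tendsto_nhdsWithin_iff.2 ⟨?_, ?_⟩)
    · simpa [ContinuousWithinAt] using hcont
    · exact eventually_nhdsWithin_of_forall hpos
  have hconst (a : ℝ) : (fun _ : ℝ => a) =o[𝓝[P.speeds] u] fun s => (√(u - s))⁻¹ :=
    isLittleO_const_left.2 (.inr (tendsto_norm_atTop_atTop.comp htop))
  have hself : (fun s => (√(u - s))⁻¹) =o[𝓝[P.speeds] u] fun s => (√(u - s))⁻¹ := by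
    refine IsBigO.trans_isLittleO (.of_bound' (eventually_nhdsWithin_of_forall fun s hs => ?_))
      (((((hconst 1).add ((hconst (P.power 0)).add hP)).const_mul_left (24 * c)).add
        (hconst 1)).const_mul_left (2 / √u))
    rw [Real.norm_of_nonneg (by positivity)]
    exact (hc.inv_sqrt_sub_le hA hu.1 hs (hlt s hs)).trans (le_abs_self _)
  exact isLittleO_irrefl (eventually_nhdsWithin_of_forall fun s hs =>
    (inv_pos.2 (hpos s hs)).ne').frequently hself

/-- The power needed to run at speed `s`, with a barrier at speed `2`. -/
noncomputable def barrierPower (s : ℝ) : ℝ := 1 / (4 * (2 - s)) ^ (1 / 4 : ℝ)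

theorem barrierPower_nonneg {s : ℝ} (hs : s < 2) : 0 ≤ barrierPower s := by
  have : 0 < 4 * (2 - s) := by linarith
  unfold barrierPower
  positivity

theorem strictMonoOn_barrierPower : StrictMonoOn barrierPower (Iio 2) := by
  intro s _ v hv hsv
  have h : 0 < 4 * (2 - v) := by linarith [mem_Iio.1 hv]
  unfold barrierPower
  gcongr

theorem hasDerivAt_barrierPower {s : ℝ} (hs : s < 2) :
    HasDerivAt barrierPower (barrierPower s ^ 5) s := by
  have hpos {t : ℝ} (ht : t < 2) : 0 < 4 * (2 - t) := by linarith
  have hlin : HasDerivAt (fun s : ℝ => 4 * (2 - s)) (-4) s := by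
    simpa using ((hasDerivAt_id s).const_sub 2).const_mul 4
  have heq : barrierPower =ᶠ[𝓝 s] fun s => (4 * (2 - s)) ^ (-(1 / 4) : ℝ) := by
    filter_upwards [Iio_mem_nhds hs] with t ht
    rw [barrierPower, Real.rpow_neg (hpos ht).le, one_div]
  refine ((hlin.rpow_const (.inl (hpos hs).ne')).congr_of_eventuallyEq heq).congr_deriv ?_
  rw [heq.eq_of_nhds, ← Real.rpow_natCast, ← Real.rpow_mul (hpos hs).le]
  norm_num

theorem continuousOn_barrierPower : ContinuousOn barrierPower (Iio 2) := fun _ hs =>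
  (hasDerivAt_barrierPower hs).continuousAt.continuousWithinAt

theorem strictConvexOn_barrierPower : StrictConvexOn ℝ (Iio 2) barrierPower := by
  refine StrictMonoOn.strictConvexOn_of_deriv (convex_Iio 2) continuousOn_barrierPower ?_
  rw [interior_Iio]
  intro s hs v hv hsv
  rw [(hasDerivAt_barrierPower hs).deriv, (hasDerivAt_barrierPower hv).deriv]
  exact pow_lt_pow_left₀ (strictMonoOn_barrierPower hs hv hsv) (barrierPower_nonneg hs)
    (by norm_num)

theorem tendsto_barrierPower : Tendsto barrierPower (𝓝[<] 2) atTop := by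
  have hroot : Tendsto (fun s : ℝ => (4 * (2 - s)) ^ (1 / 4 : ℝ)) (𝓝[<] 2) (𝓝[>] 0) := by
    refine tendsto_nhdsWithin_iff.2 ⟨?_, eventually_nhdsWithin_of_forall fun s hs => ?_⟩
    · have hcont : Continuous fun s : ℝ => (4 * (2 - s)) ^ (1 / 4 : ℝ) :=
        (continuous_const.mul (continuous_const.sub continuous_id)).rpow_const
          fun _ => .inr (by norm_num)
      exact (hcont.tendsto' 2 0 (by norm_num)).mono_left nhdsWithin_le_nhds
    · exact Real.rpow_pos_of_pos (by linarith [mem_Iio.1 hs]) _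
  exact hroot.inv_tendsto_nhdsGT_zero.congr fun s => (one_div _).symm

theorem inv_sqrt_eq_two_mul_barrierPower_sq {s : ℝ} (hs : s < 2) :
    (√(2 - s))⁻¹ = 2 * barrierPower s ^ 2 := by
  have hpos : 0 < 2 - s := sub_pos.2 hs
  have hsq : ((4 * (2 - s)) ^ (1 / 4 : ℝ)) ^ 2 = 2 * √(2 - s) := by
    rw [← Real.rpow_mul_natCast (by positivity), show (1 / 4 : ℝ) * (2 : ℕ) = 1 / 2 by norm_num,
      ← Real.sqrt_eq_rpow, Real.sqrt_mul zero_le_four, show (4 : ℝ) = 2 ^ 2 by norm_num,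
      Real.sqrt_sq zero_le_two]
  rw [barrierPower, div_pow, hsq]
  field_simp

theorem isLittleO_barrierPower : barrierPower =o[𝓝[<] 2] fun s => (√(2 - s))⁻¹ := by
  have hsq : barrierPower =o[𝓝[<] 2] fun s => 2 * barrierPower s ^ 2 := by
    simpa only [pow_one, Function.comp_def] using
      ((isLittleO_pow_pow_atTop_of_lt one_lt_two).comp_tendsto tendsto_barrierPower).const_mul_right
        two_ne_zero
  exact hsq.congr' .rfl (eventually_nhdsWithin_of_forall fun s hs =>
    (inv_sqrt_eq_two_mul_barrierPower_sq hs).symm)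

/-- The power function `barrierPower` on the speeds `[0, 2)`. -/
noncomputable def barrier : PowerFunction where
  speeds := Ico 0 2
  power := barrierPower
  zero_mem := by norm_num
  speeds_nonneg _ hs := hs.1
  power_nonneg _ hs := barrierPower_nonneg hs.2
  power_continuousOn := continuousOn_barrierPower.mono Ico_subset_Iio_self

theorem theorem3 :
    ∃ P : PowerFunction,
      P.speeds = Set.Ico 0 2 ∧
      (∀ s ∈ Set.Ico (0 : ℝ) 2, P.power s = 1 / (4 * (2 - s)) ^ (1 / 4 : ℝ)) ∧
      (∀ s ∈ Set.Ico (0 : ℝ) 2, HasDerivWithinAt P.power (P.power s ^ 5) (Set.Ico 0 2) s) ∧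
      StrictConvexOn ℝ (Set.Ico 0 2) P.power ∧
      Filter.Tendsto P.power (nhdsWithin 2 (Set.Iio 2)) Filter.atTop ∧
      ∀ A : Algorithm P, A.IsNonclairvoyant → ∀ c : ℝ≥0, ¬ A.IsCompetitive c := by
  refine ⟨barrier, rfl, fun _ _ => rfl,
    fun s hs => (hasDerivAt_barrierPower hs.2).hasDerivWithinAt,
    strictConvexOn_barrierPower.subset Ico_subset_Iio_self (convex_Ico 0 2),
    tendsto_barrierPower, fun A hA c => ?_⟩
  exact not_isCompetitive_of_isLittleO hA (isLUB_Ico two_pos) right_notMem_Ico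
    (isLittleO_barrierPower.mono (nhdsWithin_mono 2 Ico_subset_Iio_self)) c
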